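/- Fix integers $n\ge 2$ and $1\le d\le n-1$. Consider the following discrete-time load balancing system with $n$ parallel queues. In time slot $k$ a random number $a(k)\in\mathbb Z_+$ of jobs arrives, all of which are routed to one queue $i^*$; then queue $i$ can serve up to $s_i(k)\in\mathbb Z_+$ jobs, so that the queue lengths satisfy $$q_i(k+1)=\max\{q_i(k)+a(k)\mathbf 1_{\{i=i^*\}}-s_i(k),\,0\},\qquad i=1,\dots,n.$$ Under power-of-$d$ choices, $i^*$ is a queue of minimal length $q_i(k)$ within a set of $d$ queues sampled uniformly at random, ties being broken uniformly at random. The $a(k)$ are i.i.d., the vectors $\boldsymbol s(k)=(s_1(k),\dots,s_n(k))$ are i.i.d. (with possibly dependent entries), and the arrivals, the services and the random choices of the router are independent of each other; $a(k)$ and every $s_i(k)$ have finite second moments. Let $\lambda=\mathbb E[a(1)]$, $\boldsymbol\mu=\mathbb E[\boldsymbol s(1)]$ and $\mu_\Sigma=\sum_{i=1}^n\mu_i>0$. Fix the law of $\boldsymbol s(1)$ and, for each $\lambda\in(0,\mu_\Sigma)$, a law of $a(1)$ with mean $\lambda$; assume that for each such $\lambda$ the Markov chain $\{\boldsymbol q(k)\}$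 is irreducible on its state space $\mathcal S_\lambda\subseteq\mathbb Z_+^n$ (a non-empty set that the chain never leaves and in which all states communicate; for instance $\mathcal S_\lambda=\mathbb Z_+^n$). The routing is called throughput optimal if for every $\lambda\in(0,\mu_\Sigma)$ the chain $\{\boldsymbol q(k)\}$ on $\mathcal S_\lambda$ is positive recurrent, i.e. every state has a finite mean return time. Let $\mu_{(1)}\le\dots\le\mu_{(n)}$ be the ordered entries of $\boldsymbol\mu$ and $$\mathcal M^{(d)}=\left\{\boldsymbol\mu\in\mathbb R^n_+:\ \frac{\sum_{i=1}^j\mu_{(i)}}{\mu_\Sigma}\ge\frac{\binom jd}{\binom nd}\ \text{ for all } d\le j\le n-1\right\}.$$ Then power-of-$d$ choices is throughput optimal if and only if $\boldsymbol\mu\in\mathcal M^{(d)}$. -/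

import Mathlib

open scoped ENNReal

noncomputable section

/-! ### Countable Markov chains given by their transition probabilities -/

/-- For the chain with transition probabilities `P`, started at `y`: the probability `P_y(T_x > k)`
that it does not visit `x` at any of the times `1, …, k`, where `T_x = min {k ≥ 1 : X(k) = x}`. -/
def survival {E : Type*} [DecidableEq E] (P : E → PMF E) (x : E) : ℕ → E → ℝ≥0∞
  | 0, _ => 1
  | k + 1, y => ∑' z, P y z * (if z = x then 0 else survival P x k z)

/-- The mean return time `E_x[T_x] = ∑_{k ≥ 0} P_x(T_x > k)`; it is `∞` in particular if the chain
fails to return to `x` with positive probability. -/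
def meanReturnTime {E : Type*} [DecidableEq E] (P : E → PMF E) (x : E) : ℝ≥0∞ :=
  ∑' k, survival P x k x

/-- `P` defines an irreducible Markov chain with state space `S`: the set `S` is non-empty, is never
left, and any two of its states can be reached from each other. -/
def IsIrreducibleOn {E : Type*} (P : E → PMF E) (S : Set E) : Prop :=
  S.Nonempty ∧ (∀ x ∈ S, (P x).support ⊆ S) ∧
    ∀ x ∈ S, ∀ y ∈ S, Relation.ReflTransGen (fun u v => v ∈ (P u).support) x y

/-- The chain with state space `S` is positive recurrent: every state has a finite mean return
time. -/
def IsPositiveRecurrentOn {E : Type*} [DecidableEq E] (P : E → PMF E) (S : Set E) : Prop :=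
  ∀ x ∈ S, meanReturnTime P x < ∞

/-! ### The load balancing system -/

/-- A (queue-length based, possibly randomized) routing algorithm: the law of the server to which
the arrivals of a time slot are sent, given the queue lengths. -/
abbrev RoutingAlgorithm (n : ℕ) : Type := (Fin n → ℕ) → PMF (Fin n)

/-- The queue lengths `q + a - s + u` after a time slot in which `a` jobs are routed to server `i`
and the potential service is `s`; the unused service `u` is what truncates the subtraction at 0. -/
def nextQueue {n : ℕ} (q : Fin n → ℕ) (i : Fin n) (a : ℕ) (s : Fin n → ℕ) : Fin n → ℕ :=
  fun l => (q l + if l = i then a else 0) - s l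

/-- Transition probabilities of the queue-length chain: given `q`, the routing decision, the number
of arrivals (with law `arr`) and the potential service vector (with law `srv`) are independent. -/
def queueChain {n : ℕ} (R : RoutingAlgorithm n) (arr : PMF ℕ) (srv : PMF (Fin n → ℕ)) :
    (Fin n → ℕ) → PMF (Fin n → ℕ) :=
  fun q => (R q).bind fun i => arr.bind fun a => srv.map (nextQueue q i a)

/-- The servers in `A` whose queue is shortest among the servers in `A`. -/
def shortestAmong {n : ℕ} (q : Fin n → ℕ) (A : Finset (Fin n)) : Finset (Fin n) :=
  A.filter fun i => ∀ l ∈ A, q i ≤ q l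

theorem shortestAmong_nonempty {n : ℕ} (q : Fin n → ℕ) {A : Finset (Fin n)} (hA : A.Nonempty) :
    (shortestAmong q A).Nonempty := by
  obtain ⟨i, hi, h⟩ := A.exists_min_image q hA
  exact ⟨i, Finset.mem_filter.2 ⟨hi, h⟩⟩

theorem nonempty_samples {n d : ℕ} (hdn : d ≤ n) :
    Nonempty {A : Finset (Fin n) // A.card = d} := by
  obtain ⟨A, -, hA⟩ := Finset.exists_subset_card_eq (s := (Finset.univ : Finset (Fin n))) (n := d)
    (by simpa using hdn)
  exact ⟨⟨A, hA⟩⟩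

/-- Power-of-`d` choices: sample a set of `d` servers uniformly at random and route to a server with
the shortest queue among these, ties being broken uniformly at random. -/
def powerOfChoices {n d : ℕ} (hd : 1 ≤ d) (hdn : d ≤ n) : RoutingAlgorithm n := fun q =>
  haveI := nonempty_samples hdn
  (PMF.uniformOfFintype {A : Finset (Fin n) // A.card = d}).bind fun A =>
    PMF.uniformOfFinset (shortestAmong q A.1)
      (shortestAmong_nonempty q (Finset.card_pos.1 (by rw [A.2]; exact hd)))

/-- The capacity region `{r ≥ 0 : r ≤ μ_Σ}` of arrival rates. -/
def capacityRegion {n : ℕ} (μ : Fin n → ℝ) : Set ℝ :=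
  {r | 0 ≤ r ∧ r ≤ ∑ i, μ i}

/-- The law `p` of a random variable `f` with mean `m` and a finite second moment. -/
def HasMeanAndFiniteSecondMoment {E : Type*} (p : PMF E) (f : E → ℕ) (m : ℝ) : Prop :=
  HasSum (fun x => (p x).toReal * (f x : ℝ)) m ∧ Summable fun x => (p x).toReal * (f x : ℝ) ^ 2

/-- Throughput optimality of `R` in the system with service law `srv` (of mean vector `μ`) and with
arrival law `arr r` at arrival rate `r`, the state space being then `S r`: the queue-length chain is
positive recurrent for all arrival rates in the interior of the capacity region. -/
def ThroughputOptimal {n : ℕ} (R : RoutingAlgorithm n) (μ : Fin n → ℝ) (srv : PMF (Fin n → ℕ))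
    (arr : ℝ → PMF ℕ) (S : ℝ → Set (Fin n → ℕ)) : Prop :=
  ∀ r ∈ interior (capacityRegion μ), IsPositiveRecurrentOn (queueChain R (arr r) srv) (S r)

/-- The sum `μ_(1) + ⋯ + μ_(j)` of the `j` smallest entries of `μ`. -/
def sumSmallest {n : ℕ} (μ : Fin n → ℝ) (j : ℕ) : ℝ :=
  ∑ i : Fin n with i.val < j, μ (Tuple.sort μ i)

/-- The polytope `M^(d)` of service rate vectors. -/
def ratePolytope (n d : ℕ) : Set (Fin n → ℝ) :=
  {μ | (∀ i, 0 ≤ μ i) ∧ ∀ j : ℕ, d ≤ j → j < n →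
    sumSmallest μ j / ∑ i, μ i ≥ (j.choose d : ℝ) / (n.choose d : ℝ)}

end

/-!
# Throughput optimality of power-of-`d` choices

Let `p_q(i)` be the probability of routing to server `i` in state `q`. A job is certain to be routed
into a set `J` of servers when all `d` sampled servers lie in `J`, which has probability
`(|J| choose d) / (n choose d)`; for the set `J` of the queues longer than `t` this is exactly the
routing probability of `J`. The polytope compares these numbers with the shares `μ(J) / μ_Σ` of the
service rate; it suffices to look at the slowest servers (`sumSmallest_le`).

*Sufficiency.* Summing over `t` the comparison for the sets `{i | t < q i}` yields
`μ_Σ ∑ p_q(i) q_i ≤ ∑ μ_i q_i` (`total_mul_mean_powerOfChoices_le`). Hence `∑ q_i²` has drift at most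
`K - 2 (1 - λ / μ_Σ) ∑ μ_i q_i`, and Foster's criterion applies
(`IsIrreducibleOn.isPositiveRecurrentOn_of_drift`). The exceptional set is finite although some `μ_i`
may vanish: a queue without service never shrinks, so by irreducibility it is constant on the state
space (`IsIrreducibleOn.eq_of_rate_eq_zero`).

*Necessity.* If the condition fails for the set `J` of the `j` slowest servers, take `λ < μ_Σ` such
that the jobs routed to `J`, at rate at least `λ (j choose d) / (n choose d)` in every state, exceed
the service rate of `J`. If the mean return time to some state were finite, the expected numbers of
visits during an excursion would form a finite invariant measure (`excursionMeasure_invariant`), under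
which inflow to `J` cannot exceed service (`mul_mean_arr_le_of_meanReturnTime_ne_top`).

Expectations are taken in `[0, ∞]`, and drift inequalities are arranged so that no subtraction occurs.
-/

noncomputable section

/-! ### Expectations under probability mass functions -/

/-- The expectation, with values in `[0, ∞]`, of `g` under the law `p`. -/
def PMF.mean {α : Type*} (p : PMF α) (g : α → ℝ≥0∞) : ℝ≥0∞ :=
  ∑' x, p x * g x

namespace PMF

variable {α β : Type*}

theorem mean_mono {p : PMF α} {g h : α → ℝ≥0∞} (H : ∀ x ∈ p.support, g x ≤ h x) :
    p.mean g ≤ p.mean h := by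
  refine ENNReal.tsum_le_tsum fun x => ?_
  by_cases hx : x ∈ p.support
  · exact mul_le_mul_right (H x hx) _
  · simp [(p.apply_eq_zero_iff x).2 hx]

theorem mean_add (p : PMF α) (g h : α → ℝ≥0∞) :
    p.mean (fun x => g x + h x) = p.mean g + p.mean h := by
  simp only [mean, mul_add, ENNReal.tsum_add]

theorem mean_const (p : PMF α) (c : ℝ≥0∞) : p.mean (fun _ => c) = c := by
  rw [mean, ENNReal.tsum_mul_right, p.tsum_coe, one_mul]

theorem mean_const_mul (p : PMF α) (c : ℝ≥0∞) (g : α → ℝ≥0∞) :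
    p.mean (fun x => c * g x) = c * p.mean g := by
  rw [mean, mean, ← ENNReal.tsum_mul_left]
  exact tsum_congr fun x => mul_left_comm _ _ _

theorem mean_sum {ι : Type*} (p : PMF α) (s : Finset ι) (g : ι → α → ℝ≥0∞) :
    p.mean (fun x => ∑ i ∈ s, g i x) = ∑ i ∈ s, p.mean (g i) := by
  simp only [mean, Finset.mul_sum]
  exact Summable.tsum_finsetSum fun i _ => ENNReal.summable

theorem mean_bind (p : PMF α) (f : α → PMF β) (g : β → ℝ≥0∞) :
    (p.bind f).mean g = p.mean fun x => (f x).mean g := by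
  simp only [mean, bind_apply, ← ENNReal.tsum_mul_right, ← ENNReal.tsum_mul_left]
  rw [ENNReal.tsum_comm]
  simp only [mul_assoc]

theorem mean_pure (a : α) (g : α → ℝ≥0∞) : (pure a).mean g = g a := by
  rw [mean, tsum_eq_single a fun x hx => by simp [pure_apply, hx]]
  simp

theorem mean_map (p : PMF α) (f : α → β) (g : β → ℝ≥0∞) :
    (p.map f).mean g = p.mean fun x => g (f x) := by
  rw [← bind_pure_comp, mean_bind]
  simp only [Function.comp_apply, mean_pure]

theorem mean_eq_of_support {p : PMF α} {g : α → ℝ≥0∞} {c : ℝ≥0∞} (H : ∀ x ∈ p.support, g x = c) :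
    p.mean g = c :=
  (le_antisymm (mean_mono fun x hx => (H x hx).le)
    (mean_mono fun x hx => (H x hx).ge)).trans (p.mean_const c)

end PMF

theorem HasMeanAndFiniteSecondMoment.mean_eq {E : Type*} {p : PMF E} {f : E → ℕ} {m : ℝ}
    (h : HasMeanAndFiniteSecondMoment p f m) : p.mean (fun x => f x) = ENNReal.ofReal m := by
  rw [← h.1.tsum_eq, ENNReal.ofReal_tsum_of_nonneg (fun x => by positivity) h.1.summable]
  refine tsum_congr fun x => ?_
  rw [ENNReal.ofReal_mul ENNReal.toReal_nonneg, ENNReal.ofReal_toReal (p.apply_ne_top x),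
    ENNReal.ofReal_natCast]

theorem HasMeanAndFiniteSecondMoment.mean_sq_ne_top {E : Type*} {p : PMF E} {f : E → ℕ} {m : ℝ}
    (h : HasMeanAndFiniteSecondMoment p f m) : p.mean (fun x => (f x : ℝ≥0∞) ^ 2) ≠ ∞ := by
  have : p.mean (fun x => (f x : ℝ≥0∞) ^ 2) =
      ENNReal.ofReal (∑' x, (p x).toReal * (f x : ℝ) ^ 2) := by
    rw [ENNReal.ofReal_tsum_of_nonneg (fun x => by positivity) h.2]
    refine tsum_congr fun x => ?_
    rw [ENNReal.ofReal_mul ENNReal.toReal_nonneg, ENNReal.ofReal_toReal (p.apply_ne_top x),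
      ENNReal.ofReal_pow (by positivity), ENNReal.ofReal_natCast]
  rw [this]
  exact ENNReal.ofReal_ne_top

theorem HasMeanAndFiniteSecondMoment.nonneg {E : Type*} {p : PMF E} {f : E → ℕ} {m : ℝ}
    (h : HasMeanAndFiniteSecondMoment p f m) : 0 ≤ m :=
  h.1.nonneg fun x => by positivity

/-! ### The Foster–Lyapunov criterion -/

section Foster

variable {E : Type*} [DecidableEq E] {P : E → PMF E} {S : Set E}

theorem survival_succ (P : E → PMF E) (x : E) (k : ℕ) (y : E) :
    survival P x (k + 1) y = (P y).mean fun z => if z = x then 0 else survival P x k z :=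
  rfl

theorem survival_le_one (P : E → PMF E) (x : E) (k : ℕ) (y : E) : survival P x k y ≤ 1 := by
  induction k generalizing y with
  | zero => exact le_rfl
  | succ k ih =>
    rw [survival_succ]
    refine (PMF.mean_mono (h := fun _ => 1) fun z _ => ?_).trans (PMF.mean_const _ _).le
    split_ifs
    · exact zero_le_one
    · exact ih z

theorem survival_antitone (P : E → PMF E) (x y : E) : Antitone fun k => survival P x k y := by
  refine antitone_nat_of_succ_le fun k => ?_
  induction k generalizing y with
  | zero => exact survival_le_one P x 1 y
  | succ k ih =>
    rw [survival_succ, survival_succ P x k]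
    refine PMF.mean_mono fun z _ => ?_
    split_ifs
    · exact le_rfl
    · exact ih z

/-- First-step analysis of the truncated hitting time
`E_y[min (T_x) (k + 1)] = ∑_{j ≤ k} P_y(T_x > j)`. -/
theorem sum_survival_succ (P : E → PMF E) (x : E) (k : ℕ) (y : E) :
    ∑ j ∈ Finset.range (k + 1), survival P x j y =
      ((P y).mean fun z => if z = x then 0 else ∑ j ∈ Finset.range k, survival P x j z) + 1 := by
  rw [Finset.sum_range_succ']
  congr 1
  simp only [survival_succ]
  rw [← PMF.mean_sum]
  congr 1
  ext z
  split_ifs <;> simp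

/-- If one step from `y` may lead to `x`, or to a point from which `x` is missed with probability
less than one, then `x` is missed from `y` with probability less than one. -/
theorem mean_taboo_lt_one {y x z : E} (hz : z ∈ (P y).support) {h : E → ℝ≥0∞}
    (h1 : ∀ w, h w ≤ 1) (hzx : z = x ∨ h z < 1) :
    ((P y).mean fun w => if w = x then 0 else h w) < 1 := by
  rw [← (P y).tsum_coe]
  refine ENNReal.tsum_lt_tsum (i := z) ?_ (fun w => ?_) ?_
  · refine ne_top_of_le_ne_top ENNReal.one_ne_top ?_
    refine (PMF.mean_mono (h := fun _ => 1) fun w _ => ?_).trans (PMF.mean_const (P y) _).le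
    split_ifs
    · exact zero_le_one
    · exact h1 w
  · refine mul_le_of_le_one_right' ?_
    dsimp only
    split_ifs
    · exact zero_le_one
    · exact h1 w
  · have h0 : P y z ≠ 0 := hz
    have hlt : (if z = x then 0 else h z) < 1 := by
      split_ifs with hc
      · exact zero_lt_one
      · exact hzx.resolve_left hc
    calc P y z * (if z = x then 0 else h z) < P y z * 1 :=
          ENNReal.mul_lt_mul_right h0 ((P y).apply_ne_top z) hlt
      _ = P y z := mul_one _

theorem IsIrreducibleOn.exists_survival_lt_one (hS : IsIrreducibleOn P S) {x y : E}
    (hx : x ∈ S) (hy : y ∈ S) : ∃ k, survival P x k y < 1 := by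
  have key : ∀ z ∈ S, z = x ∨ ∃ k, survival P x k z < 1 := by
    intro z hz
    induction hS.2.2 z hz x hx using Relation.ReflTransGen.head_induction_on with
    | refl => exact Or.inl rfl
    | head hab _ ih =>
      rename_i a b _
      rcases ih (hS.2.1 _ hz hab) with h | ⟨k, hk⟩
      · exact Or.inr ⟨1, mean_taboo_lt_one hab (survival_le_one P x 0) (Or.inl h)⟩
      · exact Or.inr ⟨k + 1, mean_taboo_lt_one hab (survival_le_one P x k) (Or.inr hk)⟩
  obtain ⟨z, hz⟩ := (P y).support_nonempty
  rcases key z (hS.2.1 y hy hz) with h | ⟨k, hk⟩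
  · exact ⟨1, mean_taboo_lt_one hz (survival_le_one P x 0) (Or.inl h)⟩
  · exact ⟨k + 1, mean_taboo_lt_one hz (survival_le_one P x k) (Or.inr hk)⟩

/-- Foster's criterion: an irreducible chain is positive recurrent if a finite function `V` has drift
at most `-1` outside of a set that meets the state space in finitely many points, and drift bounded
above on that set. -/
theorem IsIrreducibleOn.isPositiveRecurrentOn_of_drift (hS : IsIrreducibleOn P S)
    {V : E → ℝ≥0∞} (hV : ∀ y, V y ≠ ∞) {C : Set E} (hC : (C ∩ S).Finite) {K : ℝ≥0∞} (hK : K ≠ ∞)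
    (hdrift : ∀ y ∈ S, y ∉ C → (P y).mean V + 1 ≤ V y)
    (hdrift' : ∀ y ∈ S, y ∈ C → (P y).mean V + 1 ≤ V y + K) :
    IsPositiveRecurrentOn P S := by
  intro x hx
  obtain ⟨N, hN⟩ : ∃ N, ∀ y ∈ C ∩ S, survival P x N y < 1 := by
    choose! k hk using fun y (hy : y ∈ S) => hS.exists_survival_lt_one hx hy
    refine ⟨hC.toFinset.sup k, fun y hy => lt_of_le_of_lt ?_ (hk y hy.2)⟩
    exact survival_antitone P x y (Finset.le_sup (hC.mem_toFinset.2 hy))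
  obtain ⟨c, hc, hcK⟩ : ∃ c : ℝ≥0∞, c ≠ ∞ ∧ ∀ y ∈ C ∩ S, K ≤ c * (1 - survival P x N y) := by
    refine ⟨∑ y ∈ hC.toFinset, K / (1 - survival P x N y), ?_, fun y hy => ?_⟩
    · rw [ENNReal.sum_ne_top]
      intro y hy
      exact ENNReal.div_ne_top hK (tsub_pos_of_lt (hN y (hC.mem_toFinset.1 hy))).ne'
    · have h0 : 1 - survival P x N y ≠ 0 := (tsub_pos_of_lt (hN y hy)).ne'
      have ht : 1 - survival P x N y ≠ ∞ :=
        ne_top_of_le_ne_top ENNReal.one_ne_top tsub_le_self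
      rw [← ENNReal.div_le_iff h0 ht]
      exact Finset.single_le_sum (f := fun y => K / (1 - survival P x N y))
        (fun _ _ => zero_le) (hC.mem_toFinset.2 hy)
  -- `u y = E_y[min (T_x) N]` is bounded, superharmonic for the chain killed at `x`, and strictly so
  -- on `C`, where `N` steps reach `x` with positive probability.
  set u : E → ℝ≥0∞ := fun y => ∑ j ∈ Finset.range N, survival P x j y with hu
  have hu_top : ∀ y, u y ≠ ∞ := fun y => by
    rw [hu, ENNReal.sum_ne_top]
    exact fun j _ => ne_top_of_le_ne_top ENNReal.one_ne_top (survival_le_one P x j y)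
  have hPu : ∀ y, ((P y).mean fun z => if z = x then 0 else u z) + (1 - survival P x N y) = u y := by
    intro y
    have h := sum_survival_succ P x N y
    rw [Finset.sum_range_succ] at h
    have h1 := survival_le_one P x N y
    have h1t := ne_top_of_le_ne_top ENNReal.one_ne_top h1
    rw [← ENNReal.add_left_inj h1t, add_assoc, tsub_add_cancel_of_le h1]
    exact h.symm
  -- `W = V + c u` has drift at most `-1` under the chain killed at `x`.
  have hW : ∀ y ∈ S,
      ((P y).mean fun z => if z = x then 0 else V z + c * u z) + 1 ≤ V y + c * u y := by
    intro y hy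
    have h1 : ((P y).mean fun z => if z = x then 0 else V z + c * u z) ≤
        (P y).mean V + c * (P y).mean fun z => if z = x then 0 else u z := by
      rw [← PMF.mean_const_mul, ← PMF.mean_add]
      refine PMF.mean_mono fun z _ => ?_
      split_ifs <;> simp
    set w := (P y).mean fun z => if z = x then 0 else u z
    have h2 := hPu y
    by_cases hyC : y ∈ C
    · have h3 := hcK y ⟨hyC, hy⟩
      calc _ ≤ ((P y).mean V + 1) + c * w := by rw [add_right_comm]; gcongr
        _ ≤ (V y + K) + c * w := add_le_add_left (hdrift' y hy hyC) _
        _ ≤ (V y + c * (1 - survival P x N y)) + c * w := by gcongr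
        _ = V y + c * u y := by rw [← h2]; ring
    · calc _ ≤ ((P y).mean V + 1) + c * w := by rw [add_right_comm]; gcongr
        _ ≤ V y + c * u y := by
          gcongr
          · exact hdrift y hy hyC
          · rw [← h2]; exact le_self_add
  have hbound : ∀ k, ∀ y ∈ S, ∑ j ∈ Finset.range k, survival P x j y ≤ V y + c * u y := by
    intro k
    induction k with
    | zero => simp
    | succ k ih =>
      intro y hy
      rw [sum_survival_succ]
      refine le_trans ?_ (hW y hy)
      gcongr
      refine PMF.mean_mono fun z hz => ?_
      split_ifs
      · exact le_rfl
      · exact ih z (hS.2.1 y hy hz)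
  refine lt_of_le_of_lt (b := V x + c * u x) ?_ ?_
  · rw [meanReturnTime, ENNReal.tsum_eq_iSup_nat]
    exact iSup_le fun k => hbound k x hx
  · exact (ENNReal.add_ne_top.2 ⟨hV x, ENNReal.mul_ne_top hc (hu_top x)⟩).lt_top

end Foster

/-! ### The invariant measure of a positive recurrent state -/

section Invariant

variable {E : Type*} [DecidableEq E]

/-- The law at time `k` of the chain started at `x` and killed at its first return to `x`:
`y ↦ P_x(X(k) = y, T_x > k)`. -/
def tabooLaw (P : E → PMF E) (x : E) : ℕ → E → ℝ≥0∞
  | 0, y => if y = x then 1 else 0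
  | k + 1, z => if z = x then 0 else ∑' y, tabooLaw P x k y * P y z

/-- The expected number of visits to `y` during an excursion from `x`. -/
def excursionMeasure (P : E → PMF E) (x y : E) : ℝ≥0∞ :=
  ∑' k, tabooLaw P x k y

theorem tsum_tabooLaw (P : E → PMF E) (x : E) (k : ℕ) :
    ∑' y, tabooLaw P x k y = survival P x k x := by
  -- Split the excursion at time `k`.
  have key : ∀ k j, ∑' y, tabooLaw P x k y * survival P x j y = survival P x (k + j) x := by
    intro k
    induction k with
    | zero =>
      intro j
      rw [tsum_eq_single x fun y hy => by simp [tabooLaw, hy]]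
      simp [tabooLaw]
    | succ k ih =>
      intro j
      rw [add_right_comm, add_assoc, ← ih (j + 1)]
      simp only [survival, ← ENNReal.tsum_mul_left]
      rw [ENNReal.tsum_comm]
      refine tsum_congr fun z => ?_
      simp only [tabooLaw]
      split_ifs
      · simp
      · simp only [← ENNReal.tsum_mul_right, mul_assoc]
  simpa [survival] using key k 0

theorem tsum_excursionMeasure (P : E → PMF E) (x : E) :
    ∑' y, excursionMeasure P x y = meanReturnTime P x := by
  simp only [excursionMeasure, meanReturnTime, ← tsum_tabooLaw]
  exact ENNReal.tsum_comm

theorem excursionMeasure_self (P : E → PMF E) (x : E) : excursionMeasure P x x = 1 := by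
  rw [excursionMeasure, tsum_eq_single 0]
  · simp [tabooLaw]
  · intro k hk
    obtain ⟨k, rfl⟩ := Nat.exists_eq_succ_of_ne_zero hk
    simp [tabooLaw]

theorem excursionMeasure_invariant {P : E → PMF E} {x : E} (h : meanReturnTime P x ≠ ∞) (z : E) :
    ∑' y, excursionMeasure P x y * P y z = excursionMeasure P x z := by
  have hne : ∀ z, z ≠ x →
      ∑' y, excursionMeasure P x y * P y z = excursionMeasure P x z := by
    intro z hz
    simp only [excursionMeasure, ← ENNReal.tsum_mul_right]
    rw [ENNReal.tsum_comm, tsum_eq_zero_add' (f := fun k => tabooLaw P x k z) ENNReal.summable]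
    simp [tabooLaw, hz]
  by_cases hz : z = x
  · subst hz
    -- At `x` itself, compare total masses.
    have htot : ∑' w, ∑' y, excursionMeasure P z y * P y w = ∑' w, excursionMeasure P z w := by
      rw [ENNReal.tsum_comm]
      exact tsum_congr fun y => by rw [ENNReal.tsum_mul_left, PMF.tsum_coe, mul_one]
    have hsplit : ∀ g : E → ℝ≥0∞, ∑' w, g w = g z + ∑' w, if w = z then 0 else g w := fun g =>
      ENNReal.summable.tsum_eq_add_tsum_ite' z
    rw [hsplit, hsplit (excursionMeasure P z)] at htot
    have hrest : (∑' w, if w = z then 0 else ∑' y, excursionMeasure P z y * P y w) =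
        ∑' w, if w = z then 0 else excursionMeasure P z w := by
      refine tsum_congr fun w => ?_
      split_ifs with hw
      · rfl
      · exact hne w hw
    rw [hrest] at htot
    refine (ENNReal.add_left_inj ?_).1 htot
    refine ne_top_of_le_ne_top h ?_
    rw [← tsum_excursionMeasure]
    refine ENNReal.tsum_le_tsum fun w => ?_
    split_ifs
    · exact zero_le
    · exact le_rfl
  · exact hne z hz

theorem tsum_excursionMeasure_mul_mean {P : E → PMF E} {x : E} (h : meanReturnTime P x ≠ ∞)
    (g : E → ℝ≥0∞) :
    ∑' y, excursionMeasure P x y * (P y).mean g = ∑' y, excursionMeasure P x y * g y := by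
  simp only [PMF.mean, ← ENNReal.tsum_mul_left]
  rw [ENNReal.tsum_comm]
  refine tsum_congr fun z => ?_
  simp only [← mul_assoc]
  rw [ENNReal.tsum_mul_right, excursionMeasure_invariant h]

end Invariant

/-! ### Power-of-`d` choices -/

section Routing

variable {n d : ℕ}

/-- The probability that all `d` sampled servers belong to `J`. -/
theorem mean_sample_subset (hdn : d ≤ n) (J : Finset (Fin n)) :
    haveI := nonempty_samples hdn
    (PMF.uniformOfFintype {A : Finset (Fin n) // A.card = d}).mean
      (fun A => if A.1 ⊆ J then 1 else 0) = (J.card.choose d : ℝ≥0∞) / n.choose d := by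
  have := nonempty_samples hdn
  have hcard : Fintype.card {A : Finset (Fin n) // A.card = d} = n.choose d := by
    simp
  have hsub : (∑ A : {A : Finset (Fin n) // A.card = d}, if A.1 ⊆ J then (1 : ℝ≥0∞) else 0) =
      J.card.choose d := by
    rw [Finset.sum_boole, ← Finset.card_powersetCard]
    congr 1
    refine Finset.card_bij (fun A _ => A.1) ?_ ?_ ?_
    · intro A hA
      exact Finset.mem_powersetCard.2 ⟨(Finset.mem_filter.1 hA).2, A.2⟩
    · intro A _ B _ h
      exact Subtype.ext h
    · intro A hA
      rw [Finset.mem_powersetCard] at hA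
      exact ⟨⟨A, hA.2⟩, Finset.mem_filter.2 ⟨Finset.mem_univ _, hA.1⟩, rfl⟩
  simp only [PMF.mean, PMF.uniformOfFintype_apply, tsum_fintype, ← Finset.mul_sum, hsub, hcard]
  rw [mul_comm, div_eq_mul_inv]

theorem mem_of_mem_shortestAmong {q : Fin n → ℕ} {A : Finset (Fin n)} {i : Fin n}
    (h : i ∈ shortestAmong q A) : i ∈ A :=
  (Finset.mem_filter.1 h).1

theorem le_mean_powerOfChoices (hd : 1 ≤ d) (hdn : d ≤ n) (q : Fin n → ℕ) (J : Finset (Fin n)) :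
    (J.card.choose d : ℝ≥0∞) / n.choose d ≤
      (powerOfChoices hd hdn q).mean fun i => if i ∈ J then 1 else 0 := by
  rw [← mean_sample_subset hdn J, powerOfChoices, PMF.mean_bind]
  refine PMF.mean_mono fun A _ => ?_
  split_ifs with hA
  · refine (PMF.mean_eq_of_support fun i hi => ?_).ge
    rw [PMF.support_uniformOfFinset, Finset.mem_coe] at hi
    exact if_pos (hA (mem_of_mem_shortestAmong hi))
  · exact zero_le

/-- A job joins a queue of length more than `t` iff all sampled queues are longer than `t`. -/
theorem mean_powerOfChoices_lt (hd : 1 ≤ d) (hdn : d ≤ n) (q : Fin n → ℕ) (t : ℕ) :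
    ((powerOfChoices hd hdn q).mean fun i => if t < q i then 1 else 0) =
      ((Finset.univ.filter fun i => t < q i).card.choose d : ℝ≥0∞) / n.choose d := by
  rw [← mean_sample_subset hdn, powerOfChoices, PMF.mean_bind]
  congr 1
  ext A
  refine PMF.mean_eq_of_support fun i hi => ?_
  rw [PMF.support_uniformOfFinset, Finset.mem_coe] at hi
  refine if_congr ⟨fun h l hl => ?_, fun h => ?_⟩ rfl rfl
  · exact Finset.mem_filter.2
      ⟨Finset.mem_univ _, h.trans_le ((Finset.mem_filter.1 hi).2 l hl)⟩
  · exact (Finset.mem_filter.1 (h (mem_of_mem_shortestAmong hi))).2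

/-- `sumSmallest μ j` is the least sum of `μ` over a set of `j` servers. -/
theorem sumSmallest_le (μ : Fin n → ℝ) (U : Finset (Fin n)) :
    sumSmallest μ U.card ≤ ∑ i ∈ U, μ i := by
  have hUn : U.card ≤ n := by simpa using U.card_le_univ
  set σ := Tuple.sort μ
  have hmono : Monotone (μ ∘ σ) := Tuple.monotone_sort μ
  set I : Finset (Fin n) := Finset.univ.filter fun i => i.val < U.card
  set T : Finset (Fin n) := U.map σ.symm.toEmbedding
  have hT : ∑ i ∈ T, μ (σ i) = ∑ i ∈ U, μ i := by simp [T]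
  have hIc : I.card = U.card := by
    simp [I, Fin.card_filter_val_lt, hUn]
  have hTc : T.card = U.card := Finset.card_map _
  -- `c` separates the `U.card` smallest entries from the others.
  obtain ⟨c, hcI, hcI'⟩ : ∃ c, (∀ i ∈ I, μ (σ i) ≤ c) ∧ ∀ i ∉ I, c ≤ μ (σ i) := by
    by_cases h : U.card < n
    · refine ⟨μ (σ ⟨U.card, h⟩), fun i hi => ?_, fun i hi => ?_⟩
      · exact hmono (show i ≤ ⟨U.card, h⟩ from (Finset.mem_filter.1 hi).2.le)
      · refine hmono (show (⟨U.card, h⟩ : Fin n) ≤ i from ?_)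
        simpa [I, Fin.le_def] using hi
    · refine ⟨∑ i, |μ (σ i)|, fun i _ => ?_, fun i hi => absurd ?_ hi⟩
      · exact (le_abs_self _).trans
          (Finset.single_le_sum (f := fun i => |μ (σ i)|) (fun _ _ => abs_nonneg _)
            (Finset.mem_univ i))
      · simp only [I, Finset.mem_filter, Finset.mem_univ, true_and]
        omega
  have hkey : ∑ i ∈ I, (μ (σ i) - c) ≤ ∑ i ∈ T, (μ (σ i) - c) := by
    rw [← Finset.sum_inter_add_sum_sdiff I T, ← Finset.sum_inter_add_sum_sdiff T I,
      Finset.inter_comm T I]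
    have h1 : ∑ i ∈ I \ T, (μ (σ i) - c) ≤ 0 := Finset.sum_nonpos fun i hi =>
      sub_nonpos.2 (hcI i (Finset.mem_sdiff.1 hi).1)
    have h2 : 0 ≤ ∑ i ∈ T \ I, (μ (σ i) - c) := Finset.sum_nonneg fun i hi =>
      sub_nonneg.2 (hcI' i (Finset.mem_sdiff.1 hi).2)
    linarith
  simp only [Finset.sum_sub_distrib, Finset.sum_const, hIc, hTc, hT] at hkey
  change ∑ i ∈ I, μ (σ i) ≤ _
  linarith

theorem exists_card_eq_sum_eq_sumSmallest (μ : Fin n → ℝ) {j : ℕ} (hj : j ≤ n) :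
    ∃ J : Finset (Fin n), J.card = j ∧ ∑ i ∈ J, μ i = sumSmallest μ j := by
  refine ⟨(Finset.univ.filter fun i : Fin n => i.val < j).map (Tuple.sort μ).toEmbedding, ?_, ?_⟩
  · simp [Fin.card_filter_val_lt, hj]
  · simp [sumSmallest]

/-- Under the polytope condition, every set of servers has at least the share of the total service
rate that the probability of all samples falling in it demands. -/
theorem share_le_of_mem_ratePolytope {μ : Fin n → ℝ} (hμ : 0 < ∑ i, μ i)
    (h : μ ∈ ratePolytope n d) (U : Finset (Fin n)) :
    (∑ i, μ i) * ((U.card.choose d : ℝ) / n.choose d) ≤ ∑ i ∈ U, μ i := by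
  have hU0 : 0 ≤ ∑ i ∈ U, μ i := Finset.sum_nonneg fun i _ => h.1 i
  have hUn : U.card ≤ n := by simpa using U.card_le_univ
  rcases lt_or_ge U.card d with hlt | hge
  · simpa [Nat.choose_eq_zero_of_lt hlt] using hU0
  · rcases hUn.lt_or_eq with hlt | heq
    · have h1 := h.2 U.card hge hlt
      rw [ge_iff_le, le_div_iff₀ hμ] at h1
      linarith [sumSmallest_le μ U]
    · have hU : U = Finset.univ := (Finset.card_eq_iff_eq_univ U).1 (by simpa using heq)
      subst hU
      exact mul_le_of_le_one_right hμ.le (by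
        rw [heq]
        exact div_self_le_one _)

theorem natCast_eq_sum_lt {m B : ℕ} (h : m ≤ B) :
    (m : ℝ≥0∞) = ∑ t ∈ Finset.range B, if t < m then 1 else 0 := by
  rw [Finset.sum_boole, Nat.cast_inj]
  have : (Finset.range B).filter (· < m) = Finset.range m := by
    ext t
    simp only [Finset.mem_filter, Finset.mem_range]
    omega
  rw [this, Finset.card_range]

theorem ofReal_choose_div (a b : ℕ) (hb : b ≠ 0) :
    ENNReal.ofReal ((a : ℝ) / b) = (a : ℝ≥0∞) / b := by
  rw [ENNReal.ofReal_div_of_pos (by positivity), ENNReal.ofReal_natCast, ENNReal.ofReal_natCast]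

/-- The queue joined under power-of-`d` choices is on average no longer than a queue sampled
proportionally to the service rates. Both expectations are sums over `t` of the mass of
`{i | t < q i}`. -/
theorem total_mul_mean_powerOfChoices_le (hd : 1 ≤ d) (hdn : d ≤ n) {μ : Fin n → ℝ}
    (hμ : 0 < ∑ i, μ i) (h : μ ∈ ratePolytope n d) (q : Fin n → ℕ) :
    ENNReal.ofReal (∑ i, μ i) * (powerOfChoices hd hdn q).mean (fun i => q i) ≤
      ∑ i, q i * ENNReal.ofReal (μ i) := by
  have hq : ∀ i, (q i : ℝ≥0∞) =
      ∑ t ∈ Finset.range (∑ l, q l), if t < q i then 1 else 0 := fun i =>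
    natCast_eq_sum_lt (Finset.single_le_sum (fun _ _ => Nat.zero_le _) (Finset.mem_univ i))
  simp only [hq, PMF.mean_sum, Finset.mul_sum, Finset.sum_mul]
  rw [Finset.sum_comm]
  refine Finset.sum_le_sum fun t _ => ?_
  rw [mean_powerOfChoices_lt, ← ofReal_choose_div _ _ (Nat.choose_pos hdn).ne',
    ← ENNReal.ofReal_mul hμ.le]
  simp only [ite_mul, one_mul, zero_mul]
  rw [← Finset.sum_filter, ← ENNReal.ofReal_sum_of_nonneg fun i _ => h.1 i]
  exact ENNReal.ofReal_le_ofReal (share_le_of_mem_ratePolytope hμ h _)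

end Routing

/-! ### Drift of the queue lengths -/

section Drift

variable {n : ℕ}

theorem mean_queueChain (R : RoutingAlgorithm n) (arr : PMF ℕ) (srv : PMF (Fin n → ℕ))
    (q : Fin n → ℕ) (g : (Fin n → ℕ) → ℝ≥0∞) :
    (queueChain R arr srv q).mean g =
      (R q).mean fun i => arr.mean fun a => srv.mean fun s => g (nextQueue q i a s) := by
  simp only [queueChain, PMF.mean_bind, PMF.mean_map]

theorem mem_support_queueChain {R : RoutingAlgorithm n} {arr : PMF ℕ} {srv : PMF (Fin n → ℕ)}
    {q z : Fin n → ℕ} (hz : z ∈ (queueChain R arr srv q).support) :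
    ∃ i a, ∃ s ∈ srv.support, nextQueue q i a s = z := by
  simp only [queueChain, PMF.mem_support_bind_iff, PMF.mem_support_map_iff] at hz
  obtain ⟨i, -, a, -, s, hs, h⟩ := hz
  exact ⟨i, a, s, hs, h⟩

theorem sq_tsub_add_le (q b s : ℕ) : (q + b - s) ^ 2 + 2 * (q * s) ≤
    q ^ 2 + 2 * (q * b) + b ^ 2 + s ^ 2 := by
  rcases le_total s (q + b) with h | h
  · obtain ⟨c, hc⟩ := Nat.exists_eq_add_of_le h
    rw [hc, Nat.add_sub_cancel_left]
    zify at hc ⊢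
    obtain hc : (c : ℤ) = q + b - s := by linarith
    rw [hc]
    nlinarith [mul_nonneg (Nat.cast_nonneg (α := ℤ) b) (Nat.cast_nonneg (α := ℤ) s)]
  · rw [Nat.sub_eq_zero_of_le h]
    zify
    nlinarith [sq_nonneg ((q : ℤ) - s), mul_nonneg (Nat.cast_nonneg (α := ℤ) q)
      (Nat.cast_nonneg (α := ℤ) b)]

theorem sum_sq_nextQueue_le (q : Fin n → ℕ) (i : Fin n) (a : ℕ) (s : Fin n → ℕ) :
    ∑ l, nextQueue q i a s l ^ 2 + ∑ l, 2 * (q l * s l) ≤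
      ∑ l, q l ^ 2 + 2 * (a * q i) + a ^ 2 + ∑ l, s l ^ 2 := by
  have h := Finset.sum_le_sum fun l (_ : l ∈ Finset.univ) =>
    sq_tsub_add_le (q l) (if l = i then a else 0) (s l)
  simp only [Finset.sum_add_distrib] at h
  have h1 : ∑ l, 2 * (q l * if l = i then a else 0) = 2 * (a * q i) := by
    simp [mul_comm]
  have h2 : ∑ l, (if l = i then a else 0) ^ 2 = a ^ 2 := by
    simp [ite_pow]
  rw [h1, h2] at h
  exact h

/-- An upper bound on the drift of the sum of the squares of the queue lengths; the second moments of arrivals and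
services enter as a constant. -/
theorem mean_sum_sq_add_le (R : RoutingAlgorithm n) (arr : PMF ℕ) (srv : PMF (Fin n → ℕ))
    (q : Fin n → ℕ) :
    ((queueChain R arr srv q).mean fun z => ∑ l, (z l : ℝ≥0∞) ^ 2) +
        2 * ∑ l, q l * srv.mean (fun s => s l) ≤
      ∑ l, (q l : ℝ≥0∞) ^ 2 + 2 * (arr.mean (fun a => a) * (R q).mean fun i => q i) +
        (arr.mean (fun a => (a : ℝ≥0∞) ^ 2) + ∑ l, srv.mean fun s => (s l : ℝ≥0∞) ^ 2) := by
  rw [mean_queueChain]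
  have hsrv : 2 * ∑ l, q l * srv.mean (fun s => s l) =
      srv.mean fun s => ∑ l, 2 * ((q l : ℝ≥0∞) * s l) := by
    rw [PMF.mean_sum, Finset.mul_sum]
    refine Finset.sum_congr rfl fun l _ => ?_
    rw [PMF.mean_const_mul, PMF.mean_const_mul]
  have hs : ∀ i a, (srv.mean fun s => ∑ l, (nextQueue q i a s l : ℝ≥0∞) ^ 2) +
      2 * ∑ l, q l * srv.mean (fun s => s l) ≤
        ∑ l, (q l : ℝ≥0∞) ^ 2 + 2 * q i * a + a ^ 2 + ∑ l, srv.mean fun s => (s l : ℝ≥0∞) ^ 2 := by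
    intro i a
    rw [hsrv, ← PMF.mean_add, ← PMF.mean_sum, ← PMF.mean_const srv
      (∑ l, (q l : ℝ≥0∞) ^ 2 + 2 * q i * a + a ^ 2), ← PMF.mean_add]
    refine PMF.mean_mono fun s _ => ?_
    have := sum_sq_nextQueue_le q i a s
    have h : ((∑ l, nextQueue q i a s l ^ 2 + ∑ l, 2 * (q l * s l) : ℕ) : ℝ≥0∞) ≤
      (∑ l, q l ^ 2 + 2 * (a * q i) + a ^ 2 + ∑ l, s l ^ 2 : ℕ) := Nat.cast_le.2 this
    push_cast at h
    refine h.trans (le_of_eq ?_)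
    ring
  have ha : ∀ i, (arr.mean fun a => srv.mean fun s => ∑ l, (nextQueue q i a s l : ℝ≥0∞) ^ 2) +
      2 * ∑ l, q l * srv.mean (fun s => s l) ≤
        ∑ l, (q l : ℝ≥0∞) ^ 2 + 2 * arr.mean (fun a => a) * q i +
        (arr.mean (fun a => (a : ℝ≥0∞) ^ 2) + ∑ l, srv.mean fun s => (s l : ℝ≥0∞) ^ 2) := by
    intro i
    rw [← PMF.mean_const arr (2 * ∑ l, _), ← PMF.mean_add]
    refine (PMF.mean_mono fun a _ => hs i a).trans (le_of_eq ?_)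
    rw [PMF.mean_add, PMF.mean_add, PMF.mean_add, PMF.mean_const, PMF.mean_const,
      PMF.mean_const_mul]
    ring
  rw [← PMF.mean_const (R q) (2 * ∑ l, _), ← PMF.mean_add]
  refine (PMF.mean_mono fun i _ => ha i).trans (le_of_eq ?_)
  rw [PMF.mean_add, PMF.mean_add, PMF.mean_const, PMF.mean_const, PMF.mean_const_mul]
  ring

theorem min_sum_add_le (J : Finset (Fin n)) (N : ℕ) (q : Fin n → ℕ) (i : Fin n) (a : ℕ)
    (s : Fin n → ℕ) :
    min (∑ l ∈ J, q l) N + (if i ∈ J then min a (N - ∑ l ∈ J, q l) else 0) ≤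
      min (∑ l ∈ J, nextQueue q i a s l) N + ∑ l ∈ J, s l := by
  have h : ∑ l ∈ J, q l + (if i ∈ J then a else 0) ≤
      ∑ l ∈ J, nextQueue q i a s l + ∑ l ∈ J, s l := by
    have h1 : (if i ∈ J then a else 0) = ∑ l ∈ J, if l = i then a else 0 := by simp
    rw [h1, ← Finset.sum_add_distrib, ← Finset.sum_add_distrib]
    refine Finset.sum_le_sum fun l _ => ?_
    simp only [nextQueue]
    omega
  split_ifs at h ⊢ <;> omega

/-- A lower bound on the drift of the truncated number `min (∑ l ∈ J, q l) N` of jobs at the servers in `J`. -/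
theorem min_sum_add_le_mean (R : RoutingAlgorithm n) (arr : PMF ℕ) (srv : PMF (Fin n → ℕ))
    (J : Finset (Fin n)) (N : ℕ) (q : Fin n → ℕ) :
    ((min (∑ l ∈ J, q l) N : ℕ) : ℝ≥0∞) + ((R q).mean fun i => if i ∈ J then 1 else 0) *
        arr.mean (fun a => (min a (N - ∑ l ∈ J, q l) : ℕ)) ≤
      ((queueChain R arr srv q).mean fun z => (min (∑ l ∈ J, z l) N : ℕ)) +
        ∑ l ∈ J, srv.mean (fun s => s l) := by
  rw [mean_queueChain, ← PMF.mean_sum]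
  set b := arr.mean (fun a => (min a (N - ∑ l ∈ J, q l) : ℕ))
  rw [← PMF.mean_const (R q) ((min (∑ l ∈ J, q l) N : ℕ) : ℝ≥0∞), mul_comm,
    ← PMF.mean_const_mul, ← PMF.mean_add, ← PMF.mean_const (R q) (srv.mean _), ← PMF.mean_add]
  refine PMF.mean_mono fun i _ => ?_
  have hb : b * (if i ∈ J then 1 else 0) =
      arr.mean fun a => ((if i ∈ J then min a (N - ∑ l ∈ J, q l) else 0 : ℕ) : ℝ≥0∞) := by
    split_ifs
    · rw [mul_one]
    · rw [Nat.cast_zero, PMF.mean_const, mul_zero]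
  rw [hb, ← PMF.mean_const arr ((min (∑ l ∈ J, q l) N : ℕ) : ℝ≥0∞), ← PMF.mean_add,
    ← PMF.mean_const arr (srv.mean _), ← PMF.mean_add]
  refine PMF.mean_mono fun a _ => ?_
  rw [← PMF.mean_add, ← PMF.mean_const srv (_ + _)]
  refine PMF.mean_mono fun s _ => ?_
  exact_mod_cast min_sum_add_le J N q i a s

/-- If some state has a finite mean return time and every job is sent to `J` with probability at least
`c`, then `c` times the arrival rate is at most the service rate of `J`. This is the balance of the
number of jobs in `J` under the invariant measure of the excursions; that number is truncated because
its mean under this measure may be infinite. -/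
theorem mul_mean_arr_le_of_meanReturnTime_ne_top {R : RoutingAlgorithm n} {arr : PMF ℕ}
    {srv : PMF (Fin n → ℕ)} {x : Fin n → ℕ} (hx : meanReturnTime (queueChain R arr srv) x ≠ ∞)
    (J : Finset (Fin n)) {c : ℝ≥0∞} (hc : ∀ q, c ≤ (R q).mean fun i => if i ∈ J then 1 else 0) :
    c * arr.mean (fun a => a) ≤ ∑ l ∈ J, srv.mean fun s => s l := by
  set P := queueChain R arr srv
  set π := excursionMeasure P x
  set m := meanReturnTime P x
  set M := ∑ l ∈ J, srv.mean fun s => (s l : ℝ≥0∞)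
  set f : (Fin n → ℕ) → ℕ := fun q => ∑ l ∈ J, q l
  have hm : ∑' q, π q = m := tsum_excursionMeasure P x
  have hm0 : m ≠ 0 := by
    rw [← hm]
    intro h
    have := ENNReal.tsum_eq_zero.1 h x
    rw [show π x = 1 from excursionMeasure_self P x] at this
    exact one_ne_zero this
  have htrunc : ∀ N : ℕ, ∑' q, π q * (c * arr.mean fun a => (min a (N - f q) : ℕ)) ≤ m * M := by
    intro N
    have h1 := tsum_excursionMeasure_mul_mean hx fun q => (min (f q) N : ℕ)
    have hfin : ∑' q, π q * ((min (f q) N : ℕ) : ℝ≥0∞) ≠ ∞ := by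
      refine ne_top_of_le_ne_top (ENNReal.mul_ne_top hx (ENNReal.natCast_ne_top N)) ?_
      rw [← hm, ← ENNReal.tsum_mul_right]
      refine ENNReal.tsum_le_tsum fun q => ?_
      gcongr
      exact min_le_right _ _
    rw [← ENNReal.add_le_add_iff_left hfin, ← ENNReal.tsum_add]
    refine le_trans ?_ (add_le_add_left h1.le _)
    rw [← hm, ← ENNReal.tsum_mul_right, ← ENNReal.tsum_add]
    refine ENNReal.tsum_le_tsum fun q => ?_
    rw [← mul_add, ← mul_add]
    refine mul_le_mul_right (le_trans ?_ (min_sum_add_le_mean R arr srv J N q)) _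
    gcongr
    exact hc q
  -- Let the truncation level tend to infinity, one finite set of pairs `(q, a)` at a time.
  have hlim : ∑' qa : (Fin n → ℕ) × ℕ, π qa.1 * (c * (arr qa.2 * qa.2)) ≤ m * M := by
    rw [ENNReal.tsum_eq_iSup_sum]
    refine iSup_le fun F => ?_
    refine le_trans ?_ (htrunc (∑ qa ∈ F, (f qa.1 + qa.2)))
    simp only [PMF.mean, ← ENNReal.tsum_mul_left]
    rw [← ENNReal.tsum_prod (f := fun q a => π q * (c * (arr a *
      ((min a (∑ qa ∈ F, (f qa.1 + qa.2) - f q) : ℕ) : ℝ≥0∞))))]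
    refine le_trans (Finset.sum_le_sum fun qa hqa => ?_) (ENNReal.sum_le_tsum F)
    have := Finset.single_le_sum (f := fun qa : (Fin n → ℕ) × ℕ => f qa.1 + qa.2)
      (fun _ _ => Nat.zero_le _) hqa
    gcongr
    omega
  rw [ENNReal.tsum_prod (f := fun q a => π q * (c * (arr a * (a : ℝ≥0∞))))] at hlim
  simp only [ENNReal.tsum_mul_left, ENNReal.tsum_mul_right, hm] at hlim
  exact (ENNReal.mul_le_mul_iff_right hm0 hx).1 hlim

end Drift

/-! ### Positive recurrence and the polytope -/

section Main

variable {n d : ℕ} {μ : Fin n → ℝ} {srv : PMF (Fin n → ℕ)} {arr : PMF ℕ} {S : Set (Fin n → ℕ)}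

theorem interior_capacityRegion {μ : Fin n → ℝ} :
    interior (capacityRegion μ) = Set.Ioo 0 (∑ i, μ i) :=
  interior_Icc

/-- A queue without service never shrinks, so it is constant along an irreducible chain. -/
theorem IsIrreducibleOn.eq_of_rate_eq_zero {R : RoutingAlgorithm n}
    (hS : IsIrreducibleOn (queueChain R arr srv) S) {l : Fin n}
    (hl : srv.mean (fun s => s l) = 0) {x y : Fin n → ℕ} (hx : x ∈ S) (hy : y ∈ S) :
    x l = y l := by
  have hs : ∀ s ∈ srv.support, s l = 0 := by
    intro s hs
    have := ENNReal.tsum_eq_zero.1 hl s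
    simpa [(PMF.mem_support_iff _ _).1 hs] using this
  have hle : ∀ x ∈ S, ∀ y ∈ S, x l ≤ y l := by
    intro x hx y hy
    have hxy := hS.2.2 x hx y hy
    clear hy
    induction hxy with
    | refl => exact le_rfl
    | tail _ hbc ih =>
      obtain ⟨i, a, s, hs', rfl⟩ := mem_support_queueChain hbc
      refine ih.trans ?_
      simp only [nextQueue, hs s hs', Nat.sub_zero]
      exact Nat.le_add_right _ _
  exact le_antisymm (hle x hx y hy) (hle y hy x hx)

theorem isPositiveRecurrentOn_of_mem_ratePolytope (hd : 1 ≤ d) (hdn : d ≤ n)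
    (hsrv : ∀ i, HasMeanAndFiniteSecondMoment srv (fun s => s i) (μ i)) {r : ℝ} (hr : 0 < r)
    (hrμ : r < ∑ i, μ i) (harr : HasMeanAndFiniteSecondMoment arr (fun a => a) r)
    (hS : IsIrreducibleOn (queueChain (powerOfChoices hd hdn) arr srv) S)
    (hμ : μ ∈ ratePolytope n d) :
    IsPositiveRecurrentOn (queueChain (powerOfChoices hd hdn) arr srv) S := by
  have hμ0 : 0 < ∑ i, μ i := hr.trans hrμ
  set P := queueChain (powerOfChoices hd hdn) arr srv
  set K : ℝ≥0∞ := arr.mean (fun a => (a : ℝ≥0∞) ^ 2) + ∑ l, srv.mean fun s => (s l : ℝ≥0∞) ^ 2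
  have hK : K ≠ ∞ := by
    refine ENNReal.add_ne_top.2 ⟨harr.mean_sq_ne_top, ?_⟩
    rw [ENNReal.sum_ne_top]
    exact fun l _ => (hsrv l).mean_sq_ne_top
  set V : (Fin n → ℕ) → ℝ≥0∞ := fun q => ∑ l, (q l : ℝ≥0∞) ^ 2
  set D : (Fin n → ℕ) → ℝ≥0∞ := fun q => ∑ l, q l * ENNReal.ofReal (μ l)
  have hD : ∀ q, D q ≠ ∞ := fun q => by
    rw [ENNReal.sum_ne_top]
    exact fun l _ => ENNReal.mul_ne_top (ENNReal.natCast_ne_top _) ENNReal.ofReal_ne_top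
  -- The load `ρ` and the slack `θ = 1 - ρ`.
  obtain ⟨ρ, θ, hρ, hθ, hρθ⟩ : ∃ ρ θ : ℝ≥0∞, ENNReal.ofReal r = ρ * ENNReal.ofReal (∑ i, μ i) ∧
      θ ≠ 0 ∧ ρ + θ = 1 := by
    have hlt : r / ∑ i, μ i < 1 := (div_lt_one hμ0).2 hrμ
    refine ⟨ENNReal.ofReal (r / ∑ i, μ i), ENNReal.ofReal (1 - r / ∑ i, μ i), ?_, ?_, ?_⟩
    · rw [← ENNReal.ofReal_mul (by positivity), div_mul_cancel₀ _ hμ0.ne']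
    · simpa using hlt
    · rw [← ENNReal.ofReal_add (by positivity) (by linarith)]
      simp
  have hdrift : ∀ q, (P q).mean V + 2 * θ * D q ≤ V q + K := by
    intro q
    have h1 := mean_sum_sq_add_le (powerOfChoices hd hdn) arr srv q
    simp only [fun l => (hsrv l).mean_eq, harr.mean_eq, hρ] at h1
    have h2 := total_mul_mean_powerOfChoices_le hd hdn hμ0 hμ q
    have hρt : 2 * (ρ * D q) ≠ ∞ := by
      refine ENNReal.mul_ne_top (by simp) (ENNReal.mul_ne_top ?_ (hD q))
      exact ne_top_of_le_ne_top ENNReal.one_ne_top (hρθ ▸ le_self_add)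
    rw [← ENNReal.add_le_add_iff_right hρt]
    calc (P q).mean V + 2 * θ * D q + 2 * (ρ * D q)
        = (P q).mean V + 2 * ((ρ + θ) * D q) := by ring
      _ = (P q).mean V + 2 * D q := by rw [hρθ, one_mul]
      _ ≤ V q + 2 * (ρ * ENNReal.ofReal (∑ i, μ i) *
            (powerOfChoices hd hdn q).mean fun i => q i) + K := h1
      _ ≤ V q + 2 * (ρ * D q) + K := by rw [mul_assoc ρ]; gcongr
      _ = V q + K + 2 * (ρ * D q) := by ring
  refine hS.isPositiveRecurrentOn_of_drift (V := V) (C := {q | 2 * θ * D q < K + 1}) (K := K + 1)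
    (fun q => ?_) ?_ (by finiteness) (fun q _ hq => ?_) (fun q _ _ => ?_)
  · rw [ENNReal.sum_ne_top]
    exact fun l _ => ENNReal.pow_ne_top (ENNReal.natCast_ne_top _)
  · obtain ⟨x, hx⟩ := hS.1
    have hb : ∀ l, ∃ b : ℕ, ∀ q ∈ {q | 2 * θ * D q < K + 1} ∩ S, q l ≤ b := by
      intro l
      by_cases hl : μ l = 0
      · refine ⟨x l, fun q hq => (hS.eq_of_rate_eq_zero ?_ hq.2 hx).le⟩
        rw [(hsrv l).mean_eq, hl, ENNReal.ofReal_zero]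
      · have hl0 : ENNReal.ofReal (μ l) ≠ 0 := by
          simpa using lt_of_le_of_ne (hμ.1 l) (Ne.symm hl)
        have hcoef : 2 * θ * ENNReal.ofReal (μ l) ≠ 0 := by simp [hθ, hl0]
        obtain ⟨b, hb⟩ := ENNReal.exists_nat_gt (ENNReal.div_ne_top
          (show K + 1 ≠ ∞ by finiteness) hcoef)
        refine ⟨b, fun q hq => ?_⟩
        have h1 : (q l : ℝ≥0∞) * (2 * θ * ENNReal.ofReal (μ l)) ≤ K + 1 := by
          refine le_trans (le_trans (le_of_eq ?_) (mul_le_mul_right (Finset.single_le_sum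
            (f := fun l => (q l : ℝ≥0∞) * ENNReal.ofReal (μ l)) (fun _ _ => zero_le)
            (Finset.mem_univ l)) (2 * θ))) hq.1.le
          ring
        have h2 : (q l : ℝ≥0∞) ≤ (K + 1) / (2 * θ * ENNReal.ofReal (μ l)) := by
          refine (ENNReal.le_div_iff_mul_le (Or.inl hcoef) (Or.inr (by finiteness))).2 h1
        exact_mod_cast (h2.trans_lt hb).le
    choose b hb using hb
    exact (Set.finite_Iic b).subset fun q hq l => hb l q hq
  · have h1 : K + 1 ≤ 2 * θ * D q := not_lt.1 hq
    rw [← ENNReal.add_le_add_iff_right hK]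
    calc (P q).mean V + 1 + K = (P q).mean V + (K + 1) := by ring
      _ ≤ (P q).mean V + 2 * θ * D q := by gcongr
      _ ≤ V q + K := hdrift q
  · rw [← add_assoc]
    gcongr
    exact le_self_add.trans (hdrift q)

/-- If the polytope condition fails for the `j` slowest servers, some arrival rate `r < μ_Σ` makes
the jobs sent to them, at rate at least `r * (j.choose d / n.choose d)`, exceed their service. -/
theorem mem_ratePolytope_of_throughputOptimal (hd : 1 ≤ d) (hdn : d < n) (hμ : 0 < ∑ i, μ i)
    (hsrv : ∀ i, HasMeanAndFiniteSecondMoment srv (fun s => s i) (μ i)) {arr : ℝ → PMF ℕ}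
    (harr : ∀ r ∈ interior (capacityRegion μ),
      HasMeanAndFiniteSecondMoment (arr r) (fun a => a) r)
    {S : ℝ → Set (Fin n → ℕ)} (hS : ∀ r ∈ interior (capacityRegion μ), (S r).Nonempty)
    (h : ThroughputOptimal (powerOfChoices hd hdn.le) μ srv arr S) : μ ∈ ratePolytope n d := by
  refine ⟨fun i => (hsrv i).nonneg, fun j hdj hjn => ?_⟩
  obtain ⟨J, hJc, hJ⟩ := exists_card_eq_sum_eq_sumSmallest μ hjn.le
  have hM0 : 0 ≤ sumSmallest μ j := hJ ▸ Finset.sum_nonneg fun i _ => (hsrv i).nonneg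
  have hp : (0 : ℝ) < (j.choose d : ℝ) / n.choose d :=
    div_pos (Nat.cast_pos.2 (Nat.choose_pos hdj)) (Nat.cast_pos.2 (Nat.choose_pos hdn.le))
  have key : ∀ r ∈ Set.Ioo 0 (∑ i, μ i),
      (j.choose d : ℝ) / n.choose d * r ≤ sumSmallest μ j := by
    intro r hr
    rw [← interior_capacityRegion] at hr
    obtain ⟨x, hx⟩ := hS r hr
    have h1 := mul_mean_arr_le_of_meanReturnTime_ne_top (h r hr x hx).ne J
      fun q => le_mean_powerOfChoices hd hdn.le q J
    simp only [fun l => (hsrv l).mean_eq, (harr r hr).mean_eq] at h1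
    rw [hJc, ← ofReal_choose_div _ _ (Nat.choose_pos hdn.le).ne', ← ENNReal.ofReal_mul hp.le,
      ← ENNReal.ofReal_sum_of_nonneg fun i _ => (hsrv i).nonneg, hJ] at h1
    exact (ENNReal.ofReal_le_ofReal_iff hM0).1 h1
  rw [ge_iff_le, le_div_iff₀ hμ, mul_comm, ← le_div_iff₀ hp]
  refine le_of_forall_lt_imp_le_of_dense fun r hr => ?_
  rcases le_or_gt r 0 with h0 | h0
  · exact h0.trans (div_nonneg hM0 hp.le)
  · rw [le_div_iff₀ hp, mul_comm]
    exact key r ⟨h0, hr⟩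

end Main

end

theorem theorem1 {n d : ℕ} (hd : 1 ≤ d) (hdn : d < n)
    (μ : Fin n → ℝ) (hμ : 0 < ∑ i, μ i)
    (srv : PMF (Fin n → ℕ))
    (hsrv : ∀ i, HasMeanAndFiniteSecondMoment srv (fun s => s i) (μ i))
    (arr : ℝ → PMF ℕ)
    (harr : ∀ r ∈ interior (capacityRegion μ),
      HasMeanAndFiniteSecondMoment (arr r) (fun a => a) r)
    (S : ℝ → Set (Fin n → ℕ))
    (hS : ∀ r ∈ interior (capacityRegion μ),
      IsIrreducibleOn (queueChain (powerOfChoices hd hdn.le) (arr r) srv) (S r)) :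
    ThroughputOptimal (powerOfChoices hd hdn.le) μ srv arr S ↔ μ ∈ ratePolytope n d := by
  refine ⟨mem_ratePolytope_of_throughputOptimal hd hdn hμ hsrv harr fun r hr => (hS r hr).1,
    fun h r hr => ?_⟩
  have hr' := hr
  rw [interior_capacityRegion] at hr'
  exact isPositiveRecurrentOn_of_mem_ratePolytope hd hdn.le hsrv hr'.1 hr'.2 (harr r hr) (hS r hr) h
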